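/- For a function $f:[-1,1]\to\mathbb R$ and $n\ge 0$ let $x_k=\cos\big(\pi(k+\tfrac12)/(n+1)\big)$, $0\le k\le n$, let $T_j$ be the Chebyshev polynomials of the first kind, and let $$c_0=\frac1{n+1}\sum_{k=0}^n f(x_k),\qquad c_j=\frac2{n+1}\sum_{k=0}^n f(x_k)T_j(x_k)\quad(1\le j\le n)$$ be the coefficients of the degree-$n$ Chebyshev approximation of $f$. **Algorithm 1.** Input: a symmetric matrix $B\in\mathbb R^{d\times d}$ with eigenvalues in $[\delta,1-\delta]$, where $0<\delta\le\tfrac12$, a sampling number $m$ and a polynomial degree $n$. Put $A=I-B$ and $X=\frac{1}{1-2\delta}(2A-I)$ (with $X=0$ if $\delta=\tfrac12$), and let $c_0,\dots,c_n$ be the coefficients of the degree-$n$ Chebyshev approximation of $x\mapsto\log\big(1-\frac{(1-2\delta)x+1}{2}\big)$. Draw independent Rademacher vectors $v_1,\dots,v_m\in\{-1,1\}^d$ (all coordinates independent, $\pm1$ with probability $\tfrac12$ each). For each $i$ compute $w_0=v_i$, $w_1=Xv_i$, $w_{j+1}=2Xw_j-w_{j-1}$ and $u_i=\sum_{j=0}^n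 c_jw_j$. Output $\frac1m\sum_{i=1}^m v_i^{\top}u_i$. **Algorithm 2.** Input: $C\in\mathbb R^{d\times d}$ with singular values in $[\sigma_{\min},\sigma_{\max}]$, where $0<\sigma_{\min}\le\sigma_{\max}$, and $m$, $n$. Run Algorithm 1 on $B=\frac{1}{\sigma_{\min}^2+\sigma_{\max}^2}C^{\top}C$ with $\delta=\frac{\sigma_{\min}^2}{\sigma_{\min}^2+\sigma_{\max}^2}$, sampling number $m$ and degree $n$, and let $\Gamma_1$ be its output. Output $\Gamma=\frac12\big(\Gamma_1+d\log(\sigma_{\min}^2+\sigma_{\max}^2)\big)$. **Theorem 2.** Let $\varepsilon,\zeta\in(0,1)$, let $C\in\mathbb R^{d\times d}$ be a matrix all of whose singular values lie in $[\sigma_{\min},\sigma_{\max}]$, where $0<\sigma_{\min}\le\sigma_{\max}$, and put $\kappa=\sigma_{\max}/\sigma_{\min}$. Define $$\mathcal M(\varepsilon,\kappa,\zeta)=\frac{14}{\varepsilon^2}\big(\log(1+\kappa^2)\big)^2\log\frac2\zeta,$$ $$\mathcal N(\varepsilon,\kappa)=\frac{\log\Big(\frac{20}{\varepsilon}\big(\sqrt{2\kappa^2+1}-1\big)\frac{\log(1+\kappa^2)\,\log(2\kappa^2)}{\log(1+\kappa^{-2})}\Big)}{\log\Big(\frac{\sqrt{2\kappa^2+1}+1}{\sqrt{2\kappa^2+1}-1}\Big)}.$$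 If $m\ge\mathcal M(\varepsilon,\kappa,\zeta)$ and $n\ge\mathcal N(\varepsilon,\kappa)$, then the output $\Gamma$ of Algorithm 2 satisfies $$\Pr\big[\,\big|\log|\det C|-\Gamma\big|\le\varepsilon d\,\big]\ge 1-\zeta .$$ Moreover $\mathcal N(\varepsilon,\kappa)=O\big(\kappa\log\frac\kappa\varepsilon\big)$, in the following sense: for every $a>1$ there is a constant $K$ such that $|\mathcal N(\varepsilon,\kappa)|\le K\,\kappa\log\frac\kappa\varepsilon$ for all $\varepsilon\in(0,1)$ and $\kappa\ge1$ with $\kappa/\varepsilon\ge a$. -/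

import Mathlib

open MeasureTheory ProbabilityTheory
open scoped Matrix

namespace LogDet

/-- The Chebyshev nodes `x_k = cos (π (k + 1/2) / (n + 1))`, `k = 0, …, n`. -/
noncomputable def chebNode (n k : ℕ) : ℝ :=
  Real.cos (Real.pi * ((k : ℝ) + 1 / 2) / ((n : ℝ) + 1))

/-- The `i`-th coefficient of the degree-`n` Chebyshev approximation of `f : [-1, 1] → ℝ`. -/
noncomputable def chebCoeff (f : ℝ → ℝ) (n i : ℕ) : ℝ :=
  (if i = 0 then 1 / ((n : ℝ) + 1) else 2 / ((n : ℝ) + 1)) *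
    ∑ k ∈ Finset.range (n + 1),
      f (chebNode n k) * (Polynomial.Chebyshev.T ℝ (i : ℤ)).eval (chebNode n k)

/-- The function `x ↦ log (1 - ((1 - 2δ) x + 1) / 2)` on `[-1, 1]`, that is, `t ↦ log (1 - t)` on
`[δ, 1 - δ]` pulled back along the affine map `[-1, 1] → [δ, 1 - δ]`. -/
noncomputable def scaledLog (δ x : ℝ) : ℝ :=
  Real.log (1 - ((1 - 2 * δ) * x + 1) / 2)

/-- The variables of the inner loop. -/
structure LoopState (d : ℕ) where
  /-- the last but one vector of the recursion -/
  w₀ : Fin d → ℝ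
  /-- the last vector of the recursion -/
  w₁ : Fin d → ℝ
  /-- the accumulated sum -/
  u : Fin d → ℝ

/-- One pass of the inner loop with coefficient `c`:
`w₂ ← 2 X w₁ - w₀`, `u ← u + c w₂`, `w₀ ← w₁`, `w₁ ← w₂`. -/
def loopStep {d : ℕ} (X : Matrix (Fin d) (Fin d) ℝ) (c : ℝ) (s : LoopState d) : LoopState d :=
  let w₂ := (2 : ℝ) • (X *ᵥ s.w₁) - s.w₀
  { w₀ := s.w₁
    w₁ := w₂
    u := s.u + c • w₂ }

/-- The state of the inner loop after the passes `j = 2, …, k + 1`; it starts with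
`w₀ = v`, `w₁ = X v`, `u = c₀ v + c₁ X v`. -/
def loopState {d : ℕ} (X : Matrix (Fin d) (Fin d) ℝ) (c : ℕ → ℝ) (v : Fin d → ℝ) :
    ℕ → LoopState d
  | 0 =>
    { w₀ := v
      w₁ := X *ᵥ v
      u := c 0 • v + c 1 • (X *ᵥ v) }
  | k + 1 => loopStep X (c (k + 2)) (loopState X c v k)

/-- The vector `u = ∑_{j ≤ n} c_j T_j(X) v`, as computed by the three-term recursion. -/
def chebVec {d : ℕ} (X : Matrix (Fin d) (Fin d) ℝ) (c : ℕ → ℝ) (n : ℕ) (v : Fin d → ℝ) :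
    Fin d → ℝ :=
  if 1 ≤ n then (loopState X c v (n - 1)).u else c 0 • v

/-- The matrix `(2 A - I) / (1 - 2δ)` with `A = I - B`: the image of `A` under the affine map
`[δ, 1 - δ] → [-1, 1]`. For `δ = 1/2` (where all coefficients `c_j`, `1 ≤ j ≤ n`, vanish, so that
the choice is immaterial) it is the zero matrix. -/
noncomputable def scaledMatrix {d : ℕ} (B : Matrix (Fin d) (Fin d) ℝ) (δ : ℝ) :
    Matrix (Fin d) (Fin d) ℝ :=
  (1 - 2 * δ)⁻¹ • ((2 : ℝ) • (1 - B) - 1)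

/-- The log-determinant approximation for positive definite matrices `B` with eigenvalues in
`[δ, 1 - δ]`, sampling number `m` and polynomial degree `n`, as a function of the sampled vectors
`v 0, …, v (m - 1)`. -/
noncomputable def algorithm1 {d : ℕ} (B : Matrix (Fin d) (Fin d) ℝ) (m n : ℕ) (δ : ℝ)
    (v : Fin m → Fin d → ℝ) : ℝ :=
  ∑ i : Fin m,
    (v i ⬝ᵥ chebVec (scaledMatrix B δ) (chebCoeff (scaledLog δ) n) n (v i)) / (m : ℝ)

/-- The log-determinant approximation for non-singular matrices `C` with singular values in
`[σmin, σmax]`, as a function of the sampled vectors. -/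
noncomputable def algorithm2 {d : ℕ} (C : Matrix (Fin d) (Fin d) ℝ) (σmin σmax : ℝ) (m n : ℕ)
    (v : Fin m → Fin d → ℝ) : ℝ :=
  (algorithm1 ((1 / (σmin ^ 2 + σmax ^ 2)) • (Cᵀ * C)) m n
      (σmin ^ 2 / (σmin ^ 2 + σmax ^ 2)) v
    + (d : ℝ) * Real.log (σmin ^ 2 + σmax ^ 2)) / 2

/-- `V 0, …, V (m - 1)` are independent Rademacher random vectors in `ℝ^d`: all coordinates
`V i j` are independent random variables, each equal to `1` and to `-1` with probability `1/2`. -/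
structure IsRademacherSample {Ω : Type*} [MeasurableSpace Ω] (P : Measure Ω) {m d : ℕ}
    (V : Fin m → Fin d → Ω → ℝ) : Prop where
  measurable : ∀ i j, Measurable (V i j)
  prob_one : ∀ i j, P {ω | V i j ω = 1} = 1 / 2
  prob_neg_one : ∀ i j, P {ω | V i j ω = -1} = 1 / 2
  indep : iIndepFun (fun (p : Fin m × Fin d) => V p.1 p.2) P

/-- All `d` singular values of the matrix `C` lie in the interval `[a, b]`. -/
def SingularValuesIn {d : ℕ} (C : Matrix (Fin d) (Fin d) ℝ) (a b : ℝ) : Prop :=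
  ∀ i : ℕ, i < d → (Matrix.toEuclideanLin C).singularValues i ∈ Set.Icc a b

/-- The lower bound on the sampling number. -/
noncomputable def samplingBound (ε κ ζ : ℝ) : ℝ :=
  14 / ε ^ 2 * (Real.log (1 + κ ^ 2)) ^ 2 * Real.log (2 / ζ)

/-- The lower bound on the polynomial degree. -/
noncomputable def degreeBound (ε κ : ℝ) : ℝ :=
  Real.log (20 / ε * (√(2 * κ ^ 2 + 1) - 1) *
      (Real.log (1 + κ ^ 2) * Real.log (2 * κ ^ 2) / Real.log (1 + (κ ^ 2)⁻¹))) /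
    Real.log ((√(2 * κ ^ 2 + 1) + 1) / (√(2 * κ ^ 2 + 1) - 1))

end LogDet

/-! In an orthonormal eigenbasis `e l` of `Cᵀ * C`, the inner loop applies to each scaled eigenvalue
`t l` its Chebyshev approximation `p l` of `log (t l)`, so each sample is `∑ l, p l * (e l ⬝ᵥ v) ^
2`, with mean `∑ l, p l`. Two errors remain, each at most `d ε`; the factor 1/2 in the second
algorithm leaves room for both.

Approximation: with `q = (κ - 1) / (κ + 1)` the scaled logarithm is, up to a constant, `log (1 - 2 q
x + q ^ 2)`, whose Chebyshev series has terms `-2 q ^ k / k * T_k`. Approximation in degree `n` is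
exact on `T_k` for `k ≤ n` and errs by at most `2 (n + 1)` on the others. The factor `1 / k` absorbs
`n + 1`, and a geometric tail is left (`abs_chebError_scaledLog_le`). The prescribed degree rests on
the slower rate `(s - 1) / (s + 1)`, `s = √(2κ² + 1) ≥ κ`, hence suffices.

Sampling: Rademacher vectors satisfy `v ⬝ᵥ v = d`, so a sample lies in an interval of length `d L`,
where `L = log (κ ^ 2) + 2 ε` bounds the spread of the `p l`. Hoeffding's inequality for the
independent samples gives a bound free of `d` (`measure_abs_mean_sub_ge_le`). -/

namespace LogDet

/-! ### Discrete orthogonality and the Chebyshev error functional -/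

open Polynomial.Chebyshev in
theorem sum_T_chebNode_eq_zero (n : ℕ) {k : ℤ} (hk : ¬ (2 * ((n + 1 : ℕ) : ℤ)) ∣ k) :
    ∑ l ∈ Finset.range (n + 1), (T ℝ k).eval (chebNode n l) = 0 := by
  have h := sumZeroes_T_of_not_dvd hk
  rw [sumZeroes, mul_eq_zero] at h
  have hpi : Real.pi / ((n + 1 : ℕ) : ℝ) ≠ 0 := by positivity
  rw [← h.resolve_left hpi]
  refine Finset.sum_congr rfl fun l _ => ?_
  congr 1
  unfold chebNode
  congr 1
  push_cast
  field_simp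

theorem chebNode_mem (n l : ℕ) : chebNode n l ∈ Set.Icc (-1 : ℝ) 1 :=
  Real.cos_mem_Icc _

theorem abs_T_eval_le_one {x : ℝ} (hx : x ∈ Set.Icc (-1 : ℝ) 1) (k : ℤ) :
    |(Polynomial.Chebyshev.T ℝ k).eval x| ≤ 1 := by
  rw [← Real.cos_arccos hx.1 hx.2, Polynomial.Chebyshev.T_real_cos]
  exact Real.abs_cos_le_one _

/-- Discrete orthogonality: the degree-`n` Chebyshev approximation reproduces `T_k` for `k ≤ n`. -/
theorem chebCoeff_T {n k j : ℕ} (hk : k ≤ n) (hj : j ≤ n) :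
    chebCoeff (fun x => (Polynomial.Chebyshev.T ℝ (k : ℤ)).eval x) n j = if j = k then 1 else 0 := by
  have hmul : ∀ x : ℝ, (Polynomial.Chebyshev.T ℝ (k : ℤ)).eval x *
      (Polynomial.Chebyshev.T ℝ (j : ℤ)).eval x =
      ((Polynomial.Chebyshev.T ℝ ((k : ℤ) + j)).eval x +
        (Polynomial.Chebyshev.T ℝ ((k : ℤ) - j)).eval x) / 2 := by
    intro x
    have h := congrArg (Polynomial.eval x) (Polynomial.Chebyshev.T_mul_T ℝ (k : ℤ) (j : ℤ))
    simp only [Polynomial.eval_mul, Polynomial.eval_add, Polynomial.eval_ofNat] at h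
    linarith
  have hn : (n : ℝ) + 1 ≠ 0 := by positivity
  -- The indices `k ± j` have modulus at most `2n < 2(n + 1)`, so only index 0 survives summation
  -- over the nodes.
  have hdvd : ∀ t : ℤ, t ≠ 0 → |t| ≤ 2 * n → ¬ (2 * ((n + 1 : ℕ) : ℤ)) ∣ t := by
    intro t ht htn hd
    have := Int.le_of_dvd (abs_pos.2 ht) ((dvd_abs _ _).2 hd)
    push_cast at this
    linarith
  unfold chebCoeff
  simp only [hmul, ← Finset.sum_div, Finset.sum_add_distrib]
  rcases eq_or_ne j k with rfl | hjk
  · rw [if_pos rfl, sub_self]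
    rcases eq_or_ne j 0 with rfl | hj0
    · simp
      field_simp
    · rw [if_neg hj0, sum_T_chebNode_eq_zero n (hdvd _ (by omega) (by rw [abs_le]; omega))]
      simp [hn]
  · rw [if_neg hjk, sum_T_chebNode_eq_zero n (hdvd _ (by omega) (by rw [abs_le]; omega)),
      sum_T_chebNode_eq_zero n (hdvd _ (by omega) (by rw [abs_le]; omega))]
    simp

/-- The error of the degree-`n` Chebyshev approximation of `f` at `x`. -/
noncomputable def chebError (n : ℕ) (f : ℝ → ℝ) (x : ℝ) : ℝ :=
  f x - ∑ j ∈ Finset.range (n + 1),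
    chebCoeff f n j * (Polynomial.Chebyshev.T ℝ (j : ℤ)).eval x

theorem chebError_T {n k : ℕ} (hk : k ≤ n) (x : ℝ) :
    chebError n (fun x => (Polynomial.Chebyshev.T ℝ (k : ℤ)).eval x) x = 0 := by
  unfold chebError
  rw [Finset.sum_congr rfl fun j hj => by
    rw [chebCoeff_T hk (Nat.lt_succ_iff.1 (Finset.mem_range.1 hj)), ite_mul, one_mul, zero_mul],
    Finset.sum_ite_eq']
  simp [Nat.lt_succ_iff.2 hk]

theorem abs_chebCoeff_le {f : ℝ → ℝ} (hf : ∀ x ∈ Set.Icc (-1 : ℝ) 1, |f x| ≤ 1) (n j : ℕ) :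
    |chebCoeff f n j| ≤ if j = 0 then 1 else 2 := by
  have hs : |∑ k ∈ Finset.range (n + 1),
      f (chebNode n k) * (Polynomial.Chebyshev.T ℝ (j : ℤ)).eval (chebNode n k)| ≤ (n : ℝ) + 1 := by
    refine (Finset.abs_sum_le_sum_abs _ _).trans ?_
    refine (Finset.sum_le_card_nsmul _ _ 1 fun k _ => ?_).trans (by simp)
    rw [abs_mul]
    exact mul_le_one₀ (hf _ (chebNode_mem n k)) (abs_nonneg _)
      (abs_T_eval_le_one (chebNode_mem n k) _)
  have hn : (0 : ℝ) < (n : ℝ) + 1 := by positivity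
  unfold chebCoeff
  rw [abs_mul]
  split_ifs
  · rw [abs_of_pos (by positivity), one_div, inv_mul_le_iff₀ hn]
    linarith
  · rw [abs_of_pos (by positivity), div_mul_eq_mul_div, div_le_iff₀ hn]
    linarith

/-- The coefficients contribute at most `1 + 2n` and `f` itself 1. Linear growth in `n` is harmless
because of the factor `1 / k` in the logarithmic series. -/
theorem abs_chebError_le {f : ℝ → ℝ} (hf : ∀ x ∈ Set.Icc (-1 : ℝ) 1, |f x| ≤ 1) (n : ℕ)
    {x : ℝ} (hx : x ∈ Set.Icc (-1 : ℝ) 1) : |chebError n f x| ≤ 2 * ((n : ℝ) + 1) := by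
  have h : |∑ j ∈ Finset.range (n + 1),
      chebCoeff f n j * (Polynomial.Chebyshev.T ℝ (j : ℤ)).eval x| ≤
      ∑ j ∈ Finset.range (n + 1), if j = 0 then (1 : ℝ) else 2 := by
    refine (Finset.abs_sum_le_sum_abs _ _).trans (Finset.sum_le_sum fun j _ => ?_)
    rw [abs_mul]
    exact (mul_le_of_le_one_right (abs_nonneg _) (abs_T_eval_le_one hx _)).trans
      (abs_chebCoeff_le hf n j)
  have hsum : ∑ j ∈ Finset.range (n + 1), (if j = 0 then (1 : ℝ) else 2) = n * 2 + 1 := by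
    rw [Finset.sum_range_succ']
    simp
  rw [hsum] at h
  unfold chebError
  refine (abs_sub _ _).trans ?_
  linarith [hf x hx]

theorem hasSum_chebCoeff {g : ℕ → ℝ → ℝ} {f : ℝ → ℝ}
    (h : ∀ x ∈ Set.Icc (-1 : ℝ) 1, HasSum (fun k => g k x) (f x)) (n j : ℕ) :
    HasSum (fun k => chebCoeff (g k) n j) (chebCoeff f n j) := by
  unfold chebCoeff
  exact (hasSum_sum fun l _ => (h _ (chebNode_mem n l)).mul_right _).mul_left _

/-- The error is a finite linear combination of values of `f`, so pointwise convergence is enough.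
-/
theorem hasSum_chebError {g : ℕ → ℝ → ℝ} {f : ℝ → ℝ}
    (h : ∀ x ∈ Set.Icc (-1 : ℝ) 1, HasSum (fun k => g k x) (f x)) (n : ℕ)
    {x : ℝ} (hx : x ∈ Set.Icc (-1 : ℝ) 1) :
    HasSum (fun k => chebError n (g k) x) (chebError n f x) := by
  unfold chebError
  exact (h x hx).sub (hasSum_sum fun j _ => (hasSum_chebCoeff h n j).mul_right _)

theorem chebError_const_mul (n : ℕ) (c : ℝ) (f : ℝ → ℝ) (x : ℝ) :
    chebError n (fun y => c * f y) x = c * chebError n f x := by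
  simp only [chebError, chebCoeff, mul_sub, Finset.mul_sum]
  congr 1
  refine Finset.sum_congr rfl fun j _ => ?_
  rw [Finset.sum_mul, Finset.sum_mul, Finset.mul_sum]
  exact Finset.sum_congr rfl fun k _ => by ring

theorem chebError_add_const (n : ℕ) (f : ℝ → ℝ) (c x : ℝ) :
    chebError n (fun y => f y + c) x = chebError n f x := by
  have h1 : chebError n (fun _ => (1 : ℝ)) x = 0 := by
    simpa using chebError_T (Nat.zero_le n) x
  have h2 : chebError n (fun y => f y + c) x =
      chebError n f x + c * chebError n (fun _ => (1 : ℝ)) x := by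
    rw [← chebError_const_mul]
    simp only [chebError, chebCoeff, add_mul, mul_add, Finset.sum_add_distrib]
    ring_nf
  rw [h2, h1, mul_zero, add_zero]

/-! ### Chebyshev approximation of the logarithm -/

/-- The Chebyshev expansion of `x ↦ log (1 - 2 q x + q ^ 2)`. -/
theorem hasSum_log_one_sub_two_mul_add_sq {q x : ℝ} (hq0 : 0 ≤ q) (hq : q < 1)
    (hx : x ∈ Set.Icc (-1 : ℝ) 1) :
    HasSum (fun k : ℕ => -2 * q ^ k / k * (Polynomial.Chebyshev.T ℝ (k : ℤ)).eval x)
      (Real.log (1 - 2 * q * x + q ^ 2)) := by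
  set θ := Real.arccos x with hθ
  have hc : Real.cos θ = x := Real.cos_arccos hx.1 hx.2
  set z : ℂ := q * Complex.exp (θ * Complex.I) with hz
  have hnorm : ‖z‖ < 1 := by
    rw [hz, norm_mul, Complex.norm_exp_ofReal_mul_I, mul_one, Complex.norm_real,
      Real.norm_of_nonneg hq0]
    exact hq
  have hre : z.re = q * x := by
    rw [hz, Complex.re_ofReal_mul, Complex.exp_ofReal_mul_I_re, hc]
  have him : z.im = q * Real.sin θ := by
    rw [hz, Complex.im_ofReal_mul, Complex.exp_ofReal_mul_I_im]
  -- The real part of `-log (1 - z) = ∑ z ^ k / k` at `z = q e^{iθ}`, where `cos θ = x`. The term `k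
  -- = 0` is zero because division by zero gives zero.
  have h := (Complex.hasSum_re (Complex.hasSum_taylorSeries_neg_log hnorm)).mul_left (-2)
  have hL : Real.log (1 - 2 * q * x + q ^ 2) = -2 * (-Complex.log (1 - z)).re := by
    rw [Complex.neg_re, Complex.log_re]
    have hsq : 1 - 2 * q * x + q ^ 2 = ‖1 - z‖ ^ 2 := by
      rw [Complex.sq_norm, Complex.normSq_apply]
      simp only [Complex.sub_re, Complex.sub_im, Complex.one_re, Complex.one_im, hre, him]
      have := Real.sin_sq_add_cos_sq θ
      rw [hc] at this
      linear_combination (-q ^ 2) * this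
    rw [hsq, Real.log_pow]
    push_cast
    ring
  rw [hL]
  refine h.congr_fun fun k => ?_
  have : z ^ k / (k : ℂ) = ((q ^ k / k : ℝ) : ℂ) * Complex.exp (((k * θ : ℝ) : ℂ) * Complex.I) := by
    rw [hz, mul_pow, ← Complex.exp_nat_mul]
    push_cast
    rw [mul_assoc]
    ring
  rw [this, Complex.re_ofReal_mul, Complex.exp_ofReal_mul_I_re, ← hc,
    Polynomial.Chebyshev.T_real_cos]
  push_cast
  ring

theorem abs_chebError_log_le {q : ℝ} (hq0 : 0 ≤ q) (hq : q < 1) (n : ℕ) {x : ℝ}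
    (hx : x ∈ Set.Icc (-1 : ℝ) 1) :
    |chebError n (fun y => Real.log (1 - 2 * q * y + q ^ 2)) x| ≤ 4 * (q ^ (n + 1) / (1 - q)) := by
  have h := hasSum_chebError (fun y hy => hasSum_log_one_sub_two_mul_add_sq hq0 hq hy) n hx
  simp only [chebError_const_mul] at h
  -- The terms `k ≤ n` vanish by exactness on `T_k`; only the tail remains.
  rw [← hasSum_nat_add_iff' (n + 1), Finset.sum_eq_zero, sub_zero] at h
  · have hg : HasSum (fun k : ℕ => 4 * (q ^ (n + 1) * q ^ k)) (4 * (q ^ (n + 1) / (1 - q))) :=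
      ((hasSum_geometric_of_lt_one hq0 hq).mul_left _).mul_left _
    rw [← Real.norm_eq_abs]
    refine h.norm_le_of_bounded hg fun k => ?_
    have hk : (0 : ℝ) < ((k + (n + 1) : ℕ) : ℝ) := by positivity
    have hE := abs_chebError_le (fun y hy => abs_T_eval_le_one hy ((k + (n + 1) : ℕ) : ℤ)) n hx
    rw [Real.norm_eq_abs, abs_mul, abs_div, abs_mul, abs_neg, abs_two, abs_of_pos hk,
      abs_of_nonneg (pow_nonneg hq0 _)]
    have hle : (n : ℝ) + 1 ≤ ((k + (n + 1) : ℕ) : ℝ) := by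
      push_cast
      linarith [(Nat.cast_nonneg k : (0 : ℝ) ≤ k)]
    calc _ ≤ 2 * q ^ (k + (n + 1)) / ((k + (n + 1) : ℕ) : ℝ) * (2 * ((k + (n + 1) : ℕ) : ℝ)) := by
          gcongr
          linarith
      _ = _ := by field_simp; ring
  · intro k hk
    rw [chebError_T (Nat.lt_succ_iff.1 (Finset.mem_range.1 hk)), mul_zero]

/-- The error of the Chebyshev approximation of the scaled logarithm. -/
theorem abs_chebError_scaledLog_le {κ : ℝ} (hκ : 1 ≤ κ) (n : ℕ) {x : ℝ}
    (hx : x ∈ Set.Icc (-1 : ℝ) 1) :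
    |chebError n (scaledLog (1 / (1 + κ ^ 2))) x| ≤ 2 * (κ - 1) * ((κ - 1) / (κ + 1)) ^ n := by
  -- This `q` solves `1 - 2δ = 2q / (1 + q ^ 2)` for `δ = 1 / (1 + κ ^ 2)`.
  set q := (κ - 1) / (κ + 1) with hq
  have hκ1 : 0 < κ + 1 := by linarith
  have hq0 : 0 ≤ q := div_nonneg (by linarith) hκ1.le
  have hq1 : q < 1 := by rw [hq, div_lt_one hκ1]; linarith
  have hpos : ∀ y ∈ Set.Icc (-1 : ℝ) 1, 0 < 1 - 2 * q * y + q ^ 2 := by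
    intro y hy
    nlinarith [mul_nonneg hq0 (sub_nonneg.2 hy.2), sq_pos_of_pos (sub_pos.2 hq1)]
  have hf : ∀ y ∈ Set.Icc (-1 : ℝ) 1, scaledLog (1 / (1 + κ ^ 2)) y =
      Real.log (1 - 2 * q * y + q ^ 2) + -Real.log (2 * (1 + q ^ 2)) := by
    intro y hy
    rw [← sub_eq_add_neg, ← Real.log_div (hpos y hy).ne' (by positivity), scaledLog]
    congr 1
    rw [hq]
    have : (1 + κ ^ 2) ≠ 0 := by positivity
    have h2 : (κ + 1) ^ 2 + (κ - 1) ^ 2 ≠ 0 := by positivity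
    field_simp
    ring
  have hE : chebError n (scaledLog (1 / (1 + κ ^ 2))) x = chebError n (fun y =>
      Real.log (1 - 2 * q * y + q ^ 2) + -Real.log (2 * (1 + q ^ 2))) x := by
    unfold chebError chebCoeff
    rw [hf x hx]
    congr 1
    refine Finset.sum_congr rfl fun j _ => ?_
    congr 2
    exact Finset.sum_congr rfl fun l _ => by rw [hf _ (chebNode_mem n l)]
  rw [hE, chebError_add_const]
  refine (abs_chebError_log_le hq0 hq1 n hx).trans_eq ?_
  have h1 : 1 - q = 2 / (κ + 1) := by rw [hq]; field_simp; ring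
  rw [h1, pow_succ]
  have h2 : q * (κ + 1) = κ - 1 := by rw [hq]; field_simp
  rw [← h2]
  field_simp
  ring

/-! ### Diagonalising the three-term recursion -/

/-- An orthonormal basis of right singular vectors, in coordinates. -/
theorem exists_singular_basis {d : ℕ} {C : Matrix (Fin d) (Fin d) ℝ} {a b : ℝ} (ha : 0 ≤ a)
    (hC : SingularValuesIn C a b) :
    ∃ (e : Fin d → Fin d → ℝ) (μ : Fin d → ℝ),
      (∀ i, e i ⬝ᵥ e i = 1) ∧ (∀ i w, e i ⬝ᵥ ((Cᵀ * C) *ᵥ w) = μ i * (e i ⬝ᵥ w)) ∧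
      (∀ i, μ i ∈ Set.Icc (a ^ 2) (b ^ 2)) ∧ C.det ^ 2 = ∏ i, μ i ∧
      ∀ v w, v ⬝ᵥ w = ∑ i, (e i ⬝ᵥ v) * (e i ⬝ᵥ w) := by
  set T := Matrix.toEuclideanLin C with hT
  have hd : Module.finrank ℝ (EuclideanSpace ℝ (Fin d)) = d := finrank_euclideanSpace_fin
  set E := T.isSymmetric_adjoint_comp_self.eigenvectorBasis hd with hE
  set μ := T.isSymmetric_adjoint_comp_self.eigenvalues hd with hμ
  have hadj : T.adjoint ∘ₗ T = Matrix.toEuclideanLin (Cᵀ * C) := by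
    have h := Matrix.toEuclideanLin_conjTranspose_eq_adjoint C
    rw [Matrix.conjTranspose_eq_transpose_of_trivial] at h
    rw [hT, ← h]
    ext w i
    simp [Matrix.toLpLin_apply]
  have hdot : ∀ (x : EuclideanSpace ℝ (Fin d)) (w : Fin d → ℝ),
      (x.ofLp) ⬝ᵥ w = inner ℝ x (WithLp.toLp 2 w) := by
    intro x w
    rw [EuclideanSpace.inner_eq_star_dotProduct, star_trivial, dotProduct_comm]
  refine ⟨fun i => (E i).ofLp, μ, fun i => ?_, fun i w => ?_, fun i => ?_, ?_, fun v w => ?_⟩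
  · rw [hdot]
    simp
  · have h1 := T.isSymmetric_adjoint_comp_self (E i) (WithLp.toLp 2 w)
    rw [hE, T.isSymmetric_adjoint_comp_self.apply_eigenvectorBasis hd i,
      LinearMap.congr_fun hadj, inner_smul_left] at h1
    rw [hdot, hdot]
    exact h1.symm
  · have h := hC i i.2
    rw [hμ, ← T.sq_singularValues_fin hd i]
    exact ⟨pow_le_pow_left₀ ha h.1 2, pow_le_pow_left₀ (ha.trans h.1) h.2 2⟩
  · have h := T.isSymmetric_adjoint_comp_self.det_eq_prod_eigenvalues hd
    have h2 : LinearMap.det (T.adjoint ∘ₗ T) = C.det ^ 2 := by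
      rw [hadj, Matrix.toEuclideanLin, Matrix.toLpLin_eq_toLin, LinearMap.det_toLin, Matrix.det_mul,
        Matrix.det_transpose, sq]
    rw [← h2, h]
    simp [hμ]
  · have h := E.sum_inner_mul_inner (WithLp.toLp 2 v) (WithLp.toLp 2 w)
    rw [EuclideanSpace.inner_eq_star_dotProduct, star_trivial, dotProduct_comm] at h
    rw [← h]
    refine Finset.sum_congr rfl fun i _ => ?_
    rw [hdot, hdot, real_inner_comm]

section Recursion

variable {d : ℕ} {X : Matrix (Fin d) (Fin d) ℝ} {x : ℝ} {e : Fin d → ℝ}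

/-- Pairing with a left eigenvector `e` turns the matrix recursion into the scalar recursion for
`T_k(x)`. After `k` passes the sum already reaches index `k + 1`. -/
theorem dotProduct_loopState (he : ∀ w, e ⬝ᵥ (X *ᵥ w) = x * (e ⬝ᵥ w)) (c : ℕ → ℝ)
    (v : Fin d → ℝ) (k : ℕ) :
    e ⬝ᵥ (loopState X c v k).w₀ = (Polynomial.Chebyshev.T ℝ (k : ℤ)).eval x * (e ⬝ᵥ v) ∧
    e ⬝ᵥ (loopState X c v k).w₁ = (Polynomial.Chebyshev.T ℝ (k + 1 : ℤ)).eval x * (e ⬝ᵥ v) ∧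
    e ⬝ᵥ (loopState X c v k).u = (∑ j ∈ Finset.range (k + 2),
      c j * (Polynomial.Chebyshev.T ℝ (j : ℤ)).eval x) * (e ⬝ᵥ v) := by
  induction k with
  | zero =>
    simp [loopState, he, Finset.sum_range_succ, dotProduct_add, dotProduct_smul]
    ring
  | succ k ih =>
    obtain ⟨h0, h1, hu⟩ := ih
    have hw : e ⬝ᵥ ((2 : ℝ) • (X *ᵥ (loopState X c v k).w₁) - (loopState X c v k).w₀) =
        (Polynomial.Chebyshev.T ℝ (k + 2 : ℤ)).eval x * (e ⬝ᵥ v) := by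
      rw [dotProduct_sub, dotProduct_smul, he, h0, h1, Polynomial.Chebyshev.T_add_two]
      simp
      ring
    refine ⟨?_, ?_, ?_⟩
    · simpa [loopState, loopStep] using h1
    · simp only [loopState, loopStep]
      rw [hw]
      congr 3
    · simp only [loopState, loopStep]
      rw [dotProduct_add, dotProduct_smul, hw, hu, Finset.sum_range_succ _ (k + 2)]
      push_cast
      rw [smul_eq_mul]
      ring

theorem dotProduct_chebVec (he : ∀ w, e ⬝ᵥ (X *ᵥ w) = x * (e ⬝ᵥ w)) (c : ℕ → ℝ) (n : ℕ)
    (v : Fin d → ℝ) :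
    e ⬝ᵥ chebVec X c n v = (∑ j ∈ Finset.range (n + 1),
      c j * (Polynomial.Chebyshev.T ℝ (j : ℤ)).eval x) * (e ⬝ᵥ v) := by
  unfold chebVec
  split_ifs with hn
  · obtain ⟨k, rfl⟩ := Nat.exists_eq_add_of_le' hn
    exact (dotProduct_loopState he c v k).2.2
  · obtain rfl : n = 0 := by omega
    simp [dotProduct_smul]

end Recursion

theorem dotProduct_scaledMatrix_mulVec {d : ℕ} {B : Matrix (Fin d) (Fin d) ℝ} {e : Fin d → ℝ}
    {t : ℝ} (he : ∀ w, e ⬝ᵥ (B *ᵥ w) = t * (e ⬝ᵥ w)) (δ : ℝ) (w : Fin d → ℝ) :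
    e ⬝ᵥ (scaledMatrix B δ *ᵥ w) = (1 - 2 * δ)⁻¹ * (1 - 2 * t) * (e ⬝ᵥ w) := by
  simp only [scaledMatrix, Matrix.smul_mulVec, Matrix.sub_mulVec, Matrix.one_mulVec,
    dotProduct_smul, dotProduct_sub, he, smul_eq_mul]
  ring

theorem scaledLog_apply {δ t : ℝ} (ht : t ∈ Set.Icc δ (1 - δ)) :
    scaledLog δ ((1 - 2 * δ)⁻¹ * (1 - 2 * t)) = Real.log t := by
  unfold scaledLog
  congr 1
  -- If `δ = 1/2`, the interval for `t` is the single point `1/2`, and the value of the inverse does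
  -- not matter.
  rcases eq_or_ne (1 - 2 * δ) 0 with h | h
  · have h1 := ht.1
    have h2 := ht.2
    rw [h]
    linarith
  · rw [mul_inv_cancel_left₀ h]
    ring

theorem scaled_mem_Icc {δ t : ℝ} (hδ : δ ≤ 1 / 2) (ht : t ∈ Set.Icc δ (1 - δ)) :
    (1 - 2 * δ)⁻¹ * (1 - 2 * t) ∈ Set.Icc (-1 : ℝ) 1 := by
  rw [Set.mem_Icc, ← abs_le, abs_mul, abs_inv, abs_of_nonneg (by linarith : 0 ≤ 1 - 2 * δ)]
  refine inv_mul_le_one_of_le₀ ?_ (by linarith)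
  rw [abs_le]
  constructor <;> linarith [ht.1, ht.2]

/-! ### Independence of rows and Hoeffding's inequality -/

section Independence

variable {Ω ι κ 𝓧 : Type*} [MeasurableSpace Ω] [MeasurableSpace 𝓧] {P : Measure Ω}

/-- The rows of an array of independent random variables are independent. -/
theorem iIndepFun_rows {V : ι → κ → Ω → 𝓧} (hV : ∀ i j, Measurable (V i j))
    (h : iIndepFun (fun p : ι × κ => V p.1 p.2) P) :
    iIndepFun (fun i ω j => V i j ω) P := by
  have := h.isProbabilityMeasure
  -- Currying of product measures is stated for a sigma type, hence the reindexing.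
  have h' : iIndepFun (fun (p : (_ : ι) × κ) ω => V p.1 p.2 ω) P :=
    h.precomp (Equiv.sigmaEquivProd ι κ).injective
  have : ∀ i j, IsProbabilityMeasure (P.map (V i j)) :=
    fun i j => Measure.isProbabilityMeasure_map (hV i j).aemeasurable
  have hrow : ∀ i, iIndepFun (V i) P := fun i =>
    h.precomp (g := fun j => (i, j)) (Prod.mk_right_injective i)
  have hc : (MeasurableEquiv.piCurry fun (_ : ι) (_ : κ) => 𝓧) ∘ (fun ω p => V p.1 p.2 ω) =
      fun ω i j => V i j ω := by
    ext
    simp [Sigma.curry]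
  rw [iIndepFun_iff_map_fun_eq_infinitePi_map (by fun_prop), ← hc,
    ← Measure.map_map (by fun_prop) (by fun_prop),
    (iIndepFun_iff_map_fun_eq_infinitePi_map (by fun_prop)).1 h',
    Measure.infinitePi_map_piCurry (fun i j => P.map (V i j))]
  congrm Measure.infinitePi fun i => ?_
  rw [(iIndepFun_iff_map_fun_eq_infinitePi_map (by fun_prop)).1 (hrow i)]

end Independence

/-- **Hoeffding's inequality**, two-sided, for a family of independent random variables with values
in an interval of length `L` and common mean. -/
theorem measure_abs_sum_ge_le {Ω : Type*} [MeasurableSpace Ω] {P : Measure Ω}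
    [IsProbabilityMeasure P] {m : ℕ} {Q : Fin m → Ω → ℝ} (hQ : ∀ i, Measurable (Q i))
    (hind : iIndepFun Q P) {a L M : ℝ} (hL : 0 ≤ L) (hb : ∀ i, ∀ᵐ ω ∂P, Q i ω ∈ Set.Icc a (a + L))
    (hM : ∀ i, ∫ ω, Q i ω ∂P = M) {t : ℝ} (ht : 0 ≤ t) :
    P.real {ω | t ≤ |∑ i, (Q i ω - M)|} ≤ 2 * Real.exp (-(2 * t ^ 2 / (m * L ^ 2))) := by
  -- Hoeffding's lemma: a centred variable in an interval of length `L` is sub-Gaussian with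
  -- parameter `(L / 2) ^ 2`.
  have hsub : ∀ i, HasSubgaussianMGF (fun ω => Q i ω - M) ((‖(a + L) - a‖₊ / 2) ^ 2) P := by
    intro i
    have := hasSubgaussianMGF_of_mem_Icc (hQ i).aemeasurable (hb i)
    rwa [hM i] at this
  have hexp : -t ^ 2 / (2 * ((∑ _i : Fin m, (‖(a + L) - a‖₊ / 2) ^ 2 : NNReal) : ℝ)) =
      -(2 * t ^ 2 / (m * L ^ 2)) := by
    rw [add_sub_cancel_left]
    push_cast
    rw [Real.norm_of_nonneg hL]
    simp only [Finset.sum_const, Finset.card_univ, Fintype.card_fin, nsmul_eq_mul]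
    rw [← neg_div', neg_inj, div_pow, show (2 : ℝ) * (m * (L ^ 2 / 2 ^ 2)) = m * L ^ 2 / 2 by ring,
      div_div_eq_mul_div, mul_comm]
  have hmeas : ∀ i : Fin m, Measurable fun y : ℝ => y - M := fun _ => by fun_prop
  have hup := HasSubgaussianMGF.measure_sum_ge_le_of_iIndepFun (hind.comp _ hmeas)
    (c := fun _ => (‖(a + L) - a‖₊ / 2) ^ 2) (s := Finset.univ) (fun i _ => hsub i) ht
  have hmeas' : ∀ i : Fin m, Measurable fun y : ℝ => -(y - M) := fun _ => by fun_prop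
  have hlo := HasSubgaussianMGF.measure_sum_ge_le_of_iIndepFun (hind.comp _ hmeas')
    (c := fun _ => (‖(a + L) - a‖₊ / 2) ^ 2) (s := Finset.univ) (fun i _ => (hsub i).neg) ht
  rw [hexp] at hup hlo
  have hsplit : {ω | t ≤ |∑ i, (Q i ω - M)|} ⊆
      {ω | t ≤ ∑ i, (Q i ω - M)} ∪ {ω | t ≤ ∑ i, -(Q i ω - M)} := by
    intro ω hω
    rw [Set.mem_union, Set.mem_ofPred_eq, Set.mem_ofPred_eq, Finset.sum_neg_distrib]
    exact le_abs.1 hω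
  calc _ ≤ _ := measureReal_mono hsplit
    _ ≤ _ := measureReal_union_le _ _
    _ ≤ _ := add_le_add hup hlo
    _ = _ := by ring

/-! ### Quadratic forms in Rademacher vectors -/

namespace IsRademacherSample

variable {Ω : Type*} [MeasurableSpace Ω] {P : Measure Ω} [IsProbabilityMeasure P] {m d : ℕ}
  {V : Fin m → Fin d → Ω → ℝ}

theorem ae_eq (hV : IsRademacherSample P V) (i : Fin m) (j : Fin d) :
    ∀ᵐ ω ∂P, V i j ω = 1 ∨ V i j ω = -1 := by
  have hm : ∀ c : ℝ, MeasurableSet {ω | V i j ω = c} := fun c =>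
    hV.measurable i j (measurableSet_singleton c)
  have hdisj : Disjoint {ω | V i j ω = 1} {ω | V i j ω = -1} := by
    rw [Set.disjoint_left]
    intro ω h1 h2
    rw [Set.mem_ofPred_eq] at h1 h2
    norm_num [h1] at h2
  have h : P ({ω | V i j ω = 1} ∪ {ω | V i j ω = -1}) = 1 := by
    rw [measure_union hdisj (hm _), hV.prob_one, hV.prob_neg_one, ENNReal.add_halves]
  exact (prob_compl_eq_zero_iff ((hm _).union (hm _))).2 h

theorem ae_sq (hV : IsRademacherSample P V) (i : Fin m) (j : Fin d) :
    ∀ᵐ ω ∂P, V i j ω ^ 2 = 1 := by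
  filter_upwards [hV.ae_eq i j] with ω h
  rcases h with h | h <;> rw [h] <;> norm_num

theorem integrable (hV : IsRademacherSample P V) (i : Fin m) (j : Fin d) :
    Integrable (V i j) P := by
  refine Integrable.of_mem_Icc (-1) 1 (hV.measurable i j).aemeasurable ?_
  filter_upwards [hV.ae_eq i j] with ω h
  rcases h with h | h <;> rw [h] <;> norm_num

theorem integral_eq_zero (hV : IsRademacherSample P V) (i : Fin m) (j : Fin d) :
    ∫ ω, V i j ω ∂P = 0 := by
  have hm : MeasurableSet {ω | V i j ω = 1} := hV.measurable i j (measurableSet_singleton 1)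
  have h : V i j =ᵐ[P] fun ω => 2 * {ω | V i j ω = 1}.indicator (fun _ => (1 : ℝ)) ω - 1 := by
    filter_upwards [hV.ae_eq i j] with ω h
    rcases h with h | h
    · rw [Set.indicator_of_mem (show ω ∈ {ω | V i j ω = 1} from h), h]
      norm_num
    · rw [Set.indicator_of_notMem (by rw [Set.mem_ofPred_eq, h]; norm_num), h]
      norm_num
  rw [integral_congr_ae h, integral_sub, integral_const_mul, integral_indicator_const _ hm,
    measureReal_def, hV.prob_one]
  · simp
  · exact ((integrable_const _).indicator hm).const_mul _
  · exact integrable_const _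

theorem integral_mul (hV : IsRademacherSample P V) (i : Fin m) (j k : Fin d) :
    ∫ ω, V i j ω * V i k ω ∂P = if j = k then 1 else 0 := by
  split_ifs with h
  · subst h
    have : (fun ω => V i j ω * V i j ω) =ᵐ[P] fun _ => (1 : ℝ) := by
      filter_upwards [hV.ae_sq i j] with ω h
      rw [← sq, h]
    rw [integral_congr_ae this]
    simp
  · have hind : IndepFun (V i j) (V i k) P :=
      hV.indep.indepFun (i := (i, j)) (j := (i, k)) (by simpa using h)
    rw [hind.integral_fun_mul_eq_mul_integral (hV.measurable i j).aestronglyMeasurable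
      (hV.measurable i k).aestronglyMeasurable, hV.integral_eq_zero, zero_mul]

theorem integrable_mul (hV : IsRademacherSample P V) (i : Fin m) (j k : Fin d) :
    Integrable (fun ω => V i j ω * V i k ω) P := by
  refine Integrable.of_mem_Icc (-1) 1
    ((hV.measurable i j).mul (hV.measurable i k)).aemeasurable ?_
  filter_upwards [hV.ae_eq i j, hV.ae_eq i k] with ω h h'
  rcases h with h | h <;> rcases h' with h' | h' <;> rw [h, h'] <;> norm_num

theorem sq_dotProduct (e v : Fin d → ℝ) :
    (e ⬝ᵥ v) ^ 2 = ∑ j, ∑ k, e j * e k * (v j * v k) := by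
  rw [sq, dotProduct, Finset.sum_mul_sum]
  exact Finset.sum_congr rfl fun j _ => Finset.sum_congr rfl fun k _ => by ring

theorem integrable_sq_dotProduct (hV : IsRademacherSample P V) (i : Fin m) (e : Fin d → ℝ) :
    Integrable (fun ω => (e ⬝ᵥ fun j => V i j ω) ^ 2) P := by
  simp only [sq_dotProduct]
  exact integrable_finsetSum _ fun j _ => integrable_finsetSum _ fun k _ =>
    (hV.integrable_mul i j k).const_mul _

theorem integral_sq_dotProduct (hV : IsRademacherSample P V) (i : Fin m) (e : Fin d → ℝ) :
    ∫ ω, (e ⬝ᵥ fun j => V i j ω) ^ 2 ∂P = e ⬝ᵥ e := by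
  simp only [sq_dotProduct]
  rw [integral_finsetSum _ fun j _ => integrable_finsetSum _ fun k _ =>
    (hV.integrable_mul i j k).const_mul _]
  refine Finset.sum_congr rfl fun j _ => ?_
  rw [integral_finsetSum _ fun k _ => (hV.integrable_mul i j k).const_mul _]
  simp [integral_const_mul, hV.integral_mul]

theorem ae_dotProduct_self (hV : IsRademacherSample P V) (i : Fin m) :
    ∀ᵐ ω ∂P, (fun j => V i j ω) ⬝ᵥ (fun j => V i j ω) = (d : ℝ) := by
  filter_upwards [ae_all_iff.2 fun j => hV.ae_sq i j] with ω h
  simp [dotProduct, ← sq, h]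

/-- Concentration of the mean of quadratic forms `∑ₗ p l (e l ⬝ v)²` in Rademacher vectors `v`,
where `e` is an orthonormal basis. -/
theorem measure_abs_mean_sub_ge_le (hV : IsRademacherSample P V) (hm : 0 < m)
    {e : Fin d → Fin d → ℝ} (he : ∀ l, e l ⬝ᵥ e l = 1)
    (hpars : ∀ v, v ⬝ᵥ v = ∑ l, (e l ⬝ᵥ v) ^ 2) {p : Fin d → ℝ} {a L : ℝ}
    (hp : ∀ l, p l ∈ Set.Icc a (a + L)) (hL : 0 < L) (hd : 0 < d) {s : ℝ} (hs : 0 ≤ s) :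
    P.real {ω | d * s ≤ |∑ i, (∑ l, p l * (e l ⬝ᵥ fun j => V i j ω) ^ 2) / (m : ℝ) - ∑ l, p l|} ≤
      2 * Real.exp (-(2 * m * s ^ 2 / L ^ 2)) := by
  have hm0 : (0 : ℝ) < m := by exact_mod_cast hm
  have hd0 : (0 : ℝ) < d := by exact_mod_cast hd
  have hF : Measurable fun v : Fin d → ℝ => ∑ l, p l * (e l ⬝ᵥ v) ^ 2 := by
    unfold dotProduct
    fun_prop
  have hind : iIndepFun (fun i ω => ∑ l, p l * (e l ⬝ᵥ fun j => V i j ω) ^ 2) P :=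
    (iIndepFun_rows hV.measurable hV.indep).comp (fun _ v => ∑ l, p l * (e l ⬝ᵥ v) ^ 2)
      fun _ => hF
  have hQ : ∀ i, Measurable fun ω => ∑ l, p l * (e l ⬝ᵥ fun j => V i j ω) ^ 2 := fun i =>
    hF.comp (measurable_pi_lambda _ (hV.measurable i))
  have hb : ∀ i, ∀ᵐ ω ∂P, (∑ l, p l * (e l ⬝ᵥ fun j => V i j ω) ^ 2) ∈
      Set.Icc (d * a) (d * a + d * L) := by
    intro i
    filter_upwards [hV.ae_dotProduct_self i] with ω h
    rw [hpars] at h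
    -- The weights `(e l ⬝ᵥ v) ^ 2` sum to `d`, so the quadratic form is `d` times a weighted mean
    -- of the `p l`.
    rw [← mul_add, ← h, Finset.sum_mul, Finset.sum_mul]
    constructor
    · exact Finset.sum_le_sum fun l _ => by nlinarith [(hp l).1, sq_nonneg (e l ⬝ᵥ fun j => V i j ω)]
    · exact Finset.sum_le_sum fun l _ => by nlinarith [(hp l).2, sq_nonneg (e l ⬝ᵥ fun j => V i j ω)]
  have hM : ∀ i, ∫ ω, ∑ l, p l * (e l ⬝ᵥ fun j => V i j ω) ^ 2 ∂P = ∑ l, p l := by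
    intro i
    rw [integral_finsetSum _ fun l _ => (hV.integrable_sq_dotProduct i _).const_mul _]
    simp [integral_const_mul, hV.integral_sq_dotProduct, he]
  -- Deviation `m d s` against range `d L`: the dimension cancels in the exponent.
  have h := measure_abs_sum_ge_le hQ hind (by positivity) hb hM (t := m * (d * s)) (by positivity)
  have hset : {ω | d * s ≤ |∑ i, (∑ l, p l * (e l ⬝ᵥ fun j => V i j ω) ^ 2) / (m : ℝ) - ∑ l, p l|} =
      {ω | m * (d * s) ≤ |∑ i, ((∑ l, p l * (e l ⬝ᵥ fun j => V i j ω) ^ 2) - ∑ l, p l)|} := by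
    ext ω
    rw [Set.mem_ofPred_eq, Set.mem_ofPred_eq, Finset.sum_sub_distrib, ← Finset.sum_div,
      Finset.sum_const, Finset.card_univ, Fintype.card_fin, nsmul_eq_mul, ← le_div_iff₀' hm0,
      ← abs_of_pos hm0, ← abs_div, abs_of_pos hm0, sub_div, mul_div_cancel_left₀ _ hm0.ne']
  rw [hset]
  refine h.trans_eq ?_
  congr 3
  field_simp

end IsRademacherSample

/-! ### Estimates for the sampling and degree bounds -/

section Bounds

variable {κ : ℝ}

theorem log_one_add_inv_sq_pos (hκ : 1 ≤ κ) : 0 < Real.log (1 + (κ ^ 2)⁻¹) :=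
  Real.log_pos (lt_add_of_pos_right 1 (by positivity))

theorem half_le_log_ratio (hκ : 1 ≤ κ) :
    1 / 2 ≤ Real.log (1 + κ ^ 2) * Real.log (2 * κ ^ 2) / Real.log (1 + (κ ^ 2)⁻¹) := by
  have hsq : 1 ≤ κ ^ 2 := one_le_pow₀ hκ
  have hpos := log_one_add_inv_sq_pos hκ
  have h1 : Real.log (1 + (κ ^ 2)⁻¹) ≤ Real.log (1 + κ ^ 2) :=
    Real.log_le_log (by positivity) (by linarith [inv_le_one_of_one_le₀ hsq])
  have h2 : 1 / 2 ≤ Real.log (2 * κ ^ 2) := by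
    have : Real.log 2 ≤ Real.log (2 * κ ^ 2) := Real.log_le_log (by norm_num) (by linarith)
    linarith [Real.log_two_gt_d9]
  rw [le_div_iff₀ hpos]
  nlinarith

theorem log_ratio_le (hκ : 1 ≤ κ) :
    Real.log (1 + κ ^ 2) * Real.log (2 * κ ^ 2) / Real.log (1 + (κ ^ 2)⁻¹) ≤ 4 * κ ^ 6 := by
  have hsq : 1 ≤ κ ^ 2 := one_le_pow₀ hκ
  have hpos := log_one_add_inv_sq_pos hκ
  have h1 : Real.log (1 + κ ^ 2) ≤ κ ^ 2 := by
    linarith [Real.log_le_sub_one_of_pos (show 0 < 1 + κ ^ 2 by positivity)]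
  have h2 : Real.log (2 * κ ^ 2) ≤ 2 * κ ^ 2 := by
    linarith [Real.log_le_sub_one_of_pos (show 0 < 2 * κ ^ 2 by positivity)]
  have h3 : 1 / (2 * κ ^ 2) ≤ Real.log (1 + (κ ^ 2)⁻¹) := by
    have h := Real.one_sub_inv_le_log_of_pos (show 0 < 1 + (κ ^ 2)⁻¹ by positivity)
    refine le_trans ?_ h
    have : 1 - (1 + (κ ^ 2)⁻¹)⁻¹ = 1 / (κ ^ 2 + 1) := by field_simp; ring
    rw [this]
    exact one_div_le_one_div_of_le (by positivity) (by linarith)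
  have h4 : 0 ≤ Real.log (2 * κ ^ 2) := Real.log_nonneg (by linarith)
  rw [div_le_iff₀ hpos]
  calc _ ≤ κ ^ 2 * (2 * κ ^ 2) := mul_le_mul h1 h2 h4 (by positivity)
    _ = 4 * κ ^ 6 * (1 / (2 * κ ^ 2)) := by field_simp; ring
    _ ≤ _ := by gcongr

theorem three_halves_le_sqrt (hκ : 1 ≤ κ) : 3 / 2 ≤ √(2 * κ ^ 2 + 1) :=
  Real.le_sqrt_of_sq_le (by nlinarith)

theorem le_sqrt_two_mul_sq_add_one (κ : ℝ) : κ ≤ √(2 * κ ^ 2 + 1) :=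
  Real.le_sqrt_of_sq_le (by nlinarith)

theorem sqrt_two_mul_sq_add_one_le (hκ : 1 ≤ κ) : √(2 * κ ^ 2 + 1) ≤ 2 * κ :=
  Real.sqrt_le_iff.2 ⟨by linarith, by nlinarith⟩

theorem one_lt_sqrt_ratio (hκ : 1 ≤ κ) :
    1 < (√(2 * κ ^ 2 + 1) + 1) / (√(2 * κ ^ 2 + 1) - 1) := by
  have := three_halves_le_sqrt hκ
  rw [one_lt_div (by linarith)]
  linarith

/-- The degree bound makes the error of the Chebyshev approximation at most `ε`. -/
theorem chebError_bound_le_of_degreeBound_le {ε : ℝ} (hε : 0 < ε) (hκ : 1 ≤ κ) {n : ℕ}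
    (hn : degreeBound ε κ ≤ n) : 2 * (κ - 1) * ((κ - 1) / (κ + 1)) ^ n ≤ ε := by
  unfold degreeBound at hn
  have hW := half_le_log_ratio hκ
  have hR := one_lt_sqrt_ratio hκ
  have hs := three_halves_le_sqrt hκ
  have hsκ := le_sqrt_two_mul_sq_add_one κ
  set s := √(2 * κ ^ 2 + 1)
  set W := Real.log (1 + κ ^ 2) * Real.log (2 * κ ^ 2) / Real.log (1 + (κ ^ 2)⁻¹)
  have hs1 : 0 < s - 1 := by linarith
  have harg : 0 < 20 / ε * (s - 1) * W := by positivity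
  rw [div_le_iff₀ (Real.log_pos hR), ← Real.log_pow,
    Real.log_le_log_iff harg (by positivity)] at hn
  -- The map `x ↦ (x - 1) / (x + 1)` is increasing and `κ ≤ s`.
  have hq : (κ - 1) / (κ + 1) ≤ ((s + 1) / (s - 1))⁻¹ := by
    rw [inv_div, div_le_div_iff₀ (by linarith) (by linarith)]
    nlinarith
  have hq0 : 0 ≤ (κ - 1) / (κ + 1) := div_nonneg (by linarith) (by linarith)
  calc 2 * (κ - 1) * ((κ - 1) / (κ + 1)) ^ n
      ≤ 2 * (s - 1) * (((s + 1) / (s - 1))⁻¹) ^ n := by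
        gcongr
    _ ≤ 2 * (s - 1) * (20 / ε * (s - 1) * W)⁻¹ := by
        rw [inv_pow]
        gcongr
    _ = ε * (1 / (10 * W)) := by field_simp; norm_num
    _ ≤ ε := by
        refine mul_le_of_le_one_right hε.le ?_
        rw [div_le_one (by positivity)]
        linarith

/-- The numerator is the logarithm of a number between 1 and `160 (κ / ε) ^ 7`, and `κ / ε ≥ a`
absorbs `log 160` into a multiple of `log (κ / ε)`. The denominator is at least `2 / (s + 1) ≥ 2 /
(3κ)`. -/
theorem abs_degreeBound_le {a : ℝ} (ha : 1 < a) {ε : ℝ} (hε : ε ∈ Set.Ioo (0 : ℝ) 1)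
    (hκ : 1 ≤ κ) (h : a ≤ κ / ε) :
    |degreeBound ε κ| ≤ (Real.log 160 / Real.log a + 7) * (3 / 2) * (κ * Real.log (κ / ε)) := by
  obtain ⟨hε0, hε1⟩ := hε
  unfold degreeBound
  have hW := half_le_log_ratio hκ
  have hW' := log_ratio_le hκ
  have hR := one_lt_sqrt_ratio hκ
  have hs := three_halves_le_sqrt hκ
  have hs' := sqrt_two_mul_sq_add_one_le hκ
  set s := √(2 * κ ^ 2 + 1)
  set W := Real.log (1 + κ ^ 2) * Real.log (2 * κ ^ 2) / Real.log (1 + (κ ^ 2)⁻¹)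
  have hs1 : 0 < s - 1 := by linarith
  have hla : 0 < Real.log a := Real.log_pos ha
  have hl : Real.log a ≤ Real.log (κ / ε) := Real.log_le_log (by linarith) h
  have hden : 2 / (3 * κ) ≤ Real.log ((s + 1) / (s - 1)) := by
    refine le_trans ?_ (Real.one_sub_inv_le_log_of_pos (by positivity))
    have : 1 - ((s + 1) / (s - 1))⁻¹ = 2 / (s + 1) := by field_simp; ring
    rw [this]
    exact div_le_div_of_nonneg_left (by norm_num) (by linarith) (by linarith)
  have harg1 : 1 ≤ 20 / ε * (s - 1) * W := by
    have h20 : 20 ≤ 20 / ε := by rw [le_div_iff₀ hε0]; linarith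
    calc (1 : ℝ) ≤ 20 * (1 / 2) * (1 / 2) := by norm_num
      _ ≤ 20 / ε * (s - 1) * W := by gcongr; linarith
  have harg2 : 20 / ε * (s - 1) * W ≤ 160 * (κ / ε) ^ 7 := by
    calc 20 / ε * (s - 1) * W ≤ 20 / ε * (2 * κ) * (4 * κ ^ 6) := by gcongr; linarith
      _ = 160 * (κ ^ 7 / ε) := by ring
      _ ≤ 160 * (κ ^ 7 / ε ^ 7) := by
        gcongr
        exact pow_le_of_le_one hε0.le hε1.le (by norm_num)
      _ = _ := by rw [div_pow]
  have hnum : Real.log (20 / ε * (s - 1) * W) ≤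
      (Real.log 160 / Real.log a + 7) * Real.log (κ / ε) := by
    have hpos : 0 < κ / ε := by linarith
    have h160 : Real.log 160 ≤ Real.log 160 / Real.log a * Real.log (κ / ε) := by
      rw [div_mul_eq_mul_div, le_div_iff₀ hla]
      exact mul_le_mul_of_nonneg_left hl (Real.log_nonneg (by norm_num))
    refine (Real.log_le_log (by linarith) harg2).trans ?_
    rw [Real.log_mul (by norm_num) (by positivity), Real.log_pow, add_mul]
    push_cast
    linarith
  have hnum0 := Real.log_nonneg harg1
  rw [abs_of_nonneg (div_nonneg hnum0 (Real.log_pos hR).le)]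
  calc _ ≤ (Real.log 160 / Real.log a + 7) * Real.log (κ / ε) / (2 / (3 * κ)) := by
        gcongr
        exact hnum0.trans hnum
    _ = _ := by field_simp

/-- The sampling bound makes the Hoeffding bound at most `ζ`. -/
theorem two_mul_exp_le_of_samplingBound_le {ε ζ : ℝ} (hε : ε ∈ Set.Ioo (0 : ℝ) 1)
    (hζ : ζ ∈ Set.Ioo (0 : ℝ) 1) (hκ : 1 ≤ κ) {m : ℕ} (hm : samplingBound ε κ ζ ≤ m) :
    2 * Real.exp (-(2 * m * ε ^ 2 / (Real.log (κ ^ 2) + 2 * ε) ^ 2)) ≤ ζ := by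
  obtain ⟨hε0, hε1⟩ := hε
  obtain ⟨hζ0, hζ1⟩ := hζ
  have hsq : 1 ≤ κ ^ 2 := one_le_pow₀ hκ
  have hlog0 : 0 ≤ Real.log (κ ^ 2) := Real.log_nonneg hsq
  have hlog1 : Real.log (κ ^ 2) ≤ Real.log (1 + κ ^ 2) :=
    Real.log_le_log (by linarith) (by linarith)
  have hlog2 : 0.69 ≤ Real.log (1 + κ ^ 2) := by
    have : Real.log 2 ≤ Real.log (1 + κ ^ 2) := Real.log_le_log (by norm_num) (by linarith)
    linarith [Real.log_two_gt_d9]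
  have hζ2 : 0 < Real.log (2 / ζ) := Real.log_pos (by rw [lt_div_iff₀ hζ0]; linarith)
  have hL : (Real.log (κ ^ 2) + 2 * ε) ^ 2 ≤ 28 * Real.log (1 + κ ^ 2) ^ 2 := by
    -- Here `2ε < 2 < 4 · 0.69`; squaring gives 25, below the 28 = 2 · 14 supplied by the sampling
    -- bound.
    have : Real.log (κ ^ 2) + 2 * ε ≤ 5 * Real.log (1 + κ ^ 2) := by linarith
    have := pow_le_pow_left₀ (by positivity) this 2
    nlinarith [sq_nonneg (Real.log (1 + κ ^ 2))]
  have hkey : Real.log (2 / ζ) ≤ 2 * m * ε ^ 2 / (Real.log (κ ^ 2) + 2 * ε) ^ 2 := by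
    rw [le_div_iff₀ (by positivity)]
    calc _ ≤ Real.log (2 / ζ) * (28 * Real.log (1 + κ ^ 2) ^ 2) := by gcongr
      _ = 2 * samplingBound ε κ ζ * ε ^ 2 := by
        unfold samplingBound
        field_simp
        ring
      _ ≤ _ := by gcongr
  have hexp := Real.exp_le_exp.2 (neg_le_neg hkey)
  rw [← Real.log_inv, Real.exp_log (by positivity), inv_div] at hexp
  linarith

theorem samplingBound_pos {ε ζ : ℝ} (hε : ε ∈ Set.Ioo (0 : ℝ) 1)
    (hζ : ζ ∈ Set.Ioo (0 : ℝ) 1) (hκ : 1 ≤ κ) : 0 < samplingBound ε κ ζ := by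
  have h1 : 0 < ε := hε.1
  have h2 : 0 < Real.log (1 + κ ^ 2) := Real.log_pos (lt_add_of_pos_right 1 (by positivity))
  have h3 : 0 < Real.log (2 / ζ) :=
    Real.log_pos (by rw [lt_div_iff₀ hζ.1]; linarith [hζ.2])
  unfold samplingBound
  positivity

end Bounds

/-! ### Assembling the guarantee -/

theorem algorithm1_eq {d : ℕ} {B : Matrix (Fin d) (Fin d) ℝ} {e : Fin d → Fin d → ℝ}
    {t : Fin d → ℝ} (he : ∀ l w, e l ⬝ᵥ (B *ᵥ w) = t l * (e l ⬝ᵥ w))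
    (hpars : ∀ v w, v ⬝ᵥ w = ∑ l, (e l ⬝ᵥ v) * (e l ⬝ᵥ w)) (m n : ℕ) (δ : ℝ)
    (v : Fin m → Fin d → ℝ) :
    algorithm1 B m n δ v = ∑ i, (∑ l, (∑ j ∈ Finset.range (n + 1),
      chebCoeff (scaledLog δ) n j * (Polynomial.Chebyshev.T ℝ (j : ℤ)).eval
        ((1 - 2 * δ)⁻¹ * (1 - 2 * t l))) * (e l ⬝ᵥ v i) ^ 2) / (m : ℝ) := by
  unfold algorithm1
  refine Finset.sum_congr rfl fun i _ => ?_
  congr 1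
  rw [hpars]
  refine Finset.sum_congr rfl fun l _ => ?_
  rw [dotProduct_chebVec (dotProduct_scaledMatrix_mulVec (he l) δ)]
  ring

/-- The probabilistic guarantee for the approximation of the log-determinant. -/
theorem algorithm2_guarantee {d : ℕ} {C : Matrix (Fin d) (Fin d) ℝ} {σmin σmax ε ζ : ℝ} {m n : ℕ}
    {Ω : Type*} [MeasurableSpace Ω] {P : Measure Ω} [IsProbabilityMeasure P]
    {V : Fin m → Fin d → Ω → ℝ} (hε : ε ∈ Set.Ioo (0 : ℝ) 1) (hζ : ζ ∈ Set.Ioo (0 : ℝ) 1)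
    (hmin : 0 < σmin) (hle : σmin ≤ σmax) (hC : SingularValuesIn C σmin σmax)
    (hm : samplingBound ε (σmax / σmin) ζ ≤ (m : ℝ)) (hn : degreeBound ε (σmax / σmin) ≤ (n : ℝ))
    (hV : IsRademacherSample P V) :
    1 - ζ ≤ P.real {ω | |Real.log |C.det| -
      algorithm2 C σmin σmax m n (fun i j => V i j ω)| ≤ ε * (d : ℝ)} := by
  -- The concentration bound needs `d > 0`; in dimension 0 both quantities compared are 0.
  rcases Nat.eq_zero_or_pos d with rfl | hd
  · have : {ω | |Real.log |C.det| -
        algorithm2 C σmin σmax m n (fun i j => V i j ω)| ≤ ε * ((0 : ℕ) : ℝ)} = Set.univ := by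
      ext ω
      simp [algorithm2, algorithm1]
    rw [this, probReal_univ]
    linarith [hζ.1]
  set κ := σmax / σmin with hκdef
  have hκ : 1 ≤ κ := (one_le_div hmin).2 hle
  have hmax : σmax = κ * σmin := by rw [hκdef]; field_simp
  set S := σmin ^ 2 + σmax ^ 2 with hS
  have hS0 : 0 < S := by positivity
  set δ := σmin ^ 2 / S with hδ
  have hδκ : δ = 1 / (1 + κ ^ 2) := by
    rw [hδ, hS, hmax]
    field_simp
  have hδ0 : 0 < δ := by positivity
  have hδ1 : 1 - δ = κ ^ 2 * δ := by
    rw [hδκ]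
    field_simp
    ring
  have hδ2 : δ ≤ 1 / 2 := by nlinarith [one_le_pow₀ hκ (n := 2)]
  obtain ⟨e, μ, he1, heμ, hμ, hdet, hpars⟩ := exists_singular_basis hmin.le hC
  have ht : ∀ l, 1 / S * μ l ∈ Set.Icc δ (1 - δ) := by
    intro l
    have h1 : 1 - δ = 1 / S * σmax ^ 2 := by
      rw [hδ]
      field_simp
      rw [hS]
      ring
    rw [h1, hδ, div_eq_mul_one_div, mul_comm]
    exact ⟨mul_le_mul_of_nonneg_left (hμ l).1 (by positivity),
      mul_le_mul_of_nonneg_left (hμ l).2 (by positivity)⟩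
  have heB : ∀ l w, e l ⬝ᵥ (((1 / S) • (Cᵀ * C)) *ᵥ w) = 1 / S * μ l * (e l ⬝ᵥ w) := by
    intro l w
    rw [Matrix.smul_mulVec, dotProduct_smul, heμ, smul_eq_mul, mul_assoc]
  set p : Fin d → ℝ := fun l => ∑ j ∈ Finset.range (n + 1),
    chebCoeff (scaledLog δ) n j * (Polynomial.Chebyshev.T ℝ (j : ℤ)).eval
      ((1 - 2 * δ)⁻¹ * (1 - 2 * (1 / S * μ l))) with hp
  have herr : ∀ l, |Real.log (1 / S * μ l) - p l| ≤ ε := by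
    intro l
    have h := (abs_chebError_scaledLog_le hκ n (scaled_mem_Icc hδ2 (ht l))).trans
      (chebError_bound_le_of_degreeBound_le hε.1 hκ hn)
    rwa [← hδκ, chebError, scaledLog_apply (ht l)] at h
  -- The numbers `log (t l)` spread over at most `log ((1 - δ) / δ) = log (κ ^ 2)`, and the
  -- approximation adds `ε` at each end.
  have hpIcc : ∀ l, p l ∈
      Set.Icc (Real.log δ - ε) (Real.log δ - ε + (Real.log (κ ^ 2) + 2 * ε)) := by
    intro l
    have h1 := Real.log_le_log hδ0 (ht l).1
    have h2 := Real.log_le_log (hδ0.trans_le (ht l).1) (ht l).2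
    rw [hδ1, Real.log_mul (by positivity) hδ0.ne'] at h2
    have h3 := abs_le.1 (herr l)
    constructor <;> linarith
  have hm0 : 0 < m := by exact_mod_cast (samplingBound_pos hε hζ hκ).trans_le hm
  have hL : 0 < Real.log (κ ^ 2) + 2 * ε := by
    linarith [Real.log_nonneg (one_le_pow₀ hκ (n := 2)), hε.1]
  have hbad := (hV.measure_abs_mean_sub_ge_le hm0 he1
    (fun v => (hpars v v).trans (by simp only [sq])) hpIcc hL hd hε.1.le).trans
    (two_mul_exp_le_of_samplingBound_le hε hζ hκ hm)
  have hlogdet : Real.log |C.det| =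
      ((∑ l, Real.log (1 / S * μ l)) + d * Real.log S) / 2 := by
    have hμ0 : ∀ l, 0 < μ l := fun l => (pow_pos hmin 2).trans_le (hμ l).1
    have h : 2 * Real.log |C.det| = ∑ l, Real.log (μ l) := by
      rw [← Real.log_prod fun l _ => (hμ0 l).ne', ← hdet, Real.log_pow, Real.log_abs]
      norm_num
    have h2 : ∀ l, Real.log (1 / S * μ l) = Real.log (μ l) - Real.log S := by
      intro l
      rw [one_div, inv_mul_eq_div, Real.log_div (hμ0 l).ne' hS0.ne']
    simp only [h2, Finset.sum_sub_distrib, Finset.sum_const, Finset.card_univ, Fintype.card_fin,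
      nsmul_eq_mul]
    linarith
  have hsum : |(∑ l, Real.log (1 / S * μ l)) - ∑ l, p l| ≤ d * ε := by
    rw [← Finset.sum_sub_distrib]
    refine (Finset.abs_sum_le_sum_abs _ _).trans ((Finset.sum_le_sum fun l _ => herr l).trans ?_)
    simp
  set bad := {ω | (d : ℝ) * ε ≤
    |∑ i, (∑ l, p l * (e l ⬝ᵥ fun j => V i j ω) ^ 2) / (m : ℝ) - ∑ l, p l|} with hbad_def
  set good := {ω | |Real.log |C.det| -
      algorithm2 C σmin σmax m n (fun i j => V i j ω)| ≤ ε * (d : ℝ)} with hgood_def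
  have hcover : bad ∪ good = Set.univ := by
    rw [Set.eq_univ_iff_forall]
    intro ω
    by_cases hω : ω ∈ bad
    · exact Or.inl hω
    · right
      rw [hbad_def, Set.mem_ofPred_eq, not_le] at hω
      rw [hgood_def, Set.mem_ofPred_eq, hlogdet, algorithm2, algorithm1_eq heB hpars]
      have h1 := abs_le.1 hsum
      have h2 := abs_lt.1 hω
      rw [abs_le]
      -- Halving the sum of the two errors `d ε` gives `ε d`.
      constructor <;> linarith [h1.1, h1.2, h2.1, h2.2]
  have h1 : 1 ≤ P.real bad + P.real good := by
    rw [← probReal_univ (μ := P), ← hcover]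
    exact measureReal_union_le _ _
  linarith

end LogDet

theorem theorem2 :
    -- the probabilistic guarantee
    (∀ (d : ℕ) (C : Matrix (Fin d) (Fin d) ℝ) (σmin σmax ε ζ : ℝ) (m n : ℕ)
      (Ω : Type*) [MeasurableSpace Ω] (P : Measure Ω) [IsProbabilityMeasure P]
      (V : Fin m → Fin d → Ω → ℝ),
      ε ∈ Set.Ioo (0 : ℝ) 1 → ζ ∈ Set.Ioo (0 : ℝ) 1 →
      0 < σmin → σmin ≤ σmax →
      LogDet.SingularValuesIn C σmin σmax →
      LogDet.samplingBound ε (σmax / σmin) ζ ≤ (m : ℝ) →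
      LogDet.degreeBound ε (σmax / σmin) ≤ (n : ℝ) →
      LogDet.IsRademacherSample P V →
      1 - ζ ≤ P.real {ω | |Real.log |C.det| -
        LogDet.algorithm2 C σmin σmax m n (fun i j => V i j ω)| ≤ ε * (d : ℝ)}) ∧
    -- the order of the degree bound: `O(κ log (κ / ε))`, uniformly for `κ / ε` bounded away from 1
    (∀ a : ℝ, 1 < a → ∃ K : ℝ, ∀ ε κ : ℝ, ε ∈ Set.Ioo (0 : ℝ) 1 → 1 ≤ κ → a ≤ κ / ε →
      |LogDet.degreeBound ε κ| ≤ K * (κ * Real.log (κ / ε))) :=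
  ⟨fun _ _ _ _ _ _ _ _ _ _ _ _ _ hε hζ hmin hle hC hm hn hV =>
    LogDet.algorithm2_guarantee hε hζ hmin hle hC hm hn hV,
  fun a ha => ⟨(Real.log 160 / Real.log a + 7) * (3 / 2), fun _ _ hε hκ h =>
    LogDet.abs_degreeBound_le ha hε hκ h⟩⟩
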